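/- Let $G$ be a finite simple undirected connected graph with vertex set $V(G)$ and shortest-path distance $d$. For a sequence of vertices put $\ell(x_0,\ldots,x_k)=\sum_{0\le i\le k-1} d(x_i,x_{i+1})$. For integers $k,l\ge 0$ let $\mathrm{MC}_{k,l}(G)$ be the free abelian group on the sequences $(x_0,\ldots,x_k)\in V(G)^{k+1}$ with $x_i\ne x_{i+1}$ for all $i$ and $\ell(x_0,\ldots,x_k)=l$, and let $\partial:\mathrm{MC}_{k,l}(G)\to\mathrm{MC}_{k-1,l}(G)$ be given by $\partial=\sum_{1\le i\le k-1}(-1)^i\partial_i$, where $\partial_i(x_0,\ldots,x_k)=(x_0,\ldots,\widehat{x_i},\ldots,x_k)$ if $\ell(x_0,\ldots,\widehat{x_i},\ldots,x_k)=\ell(x_0,\ldots,x_k)$, and $\partial_i(x_0,\ldots,x_k)=0$ otherwise. The magnitude homology of $G$ is $\mathrm{MH}_{k,l}(G)=H_k(\mathrm{MC}_{*,l}(G))$, and $G$ is called diagonal if $\mathrm{MH}_{k,l}(G)\ne 0$ only if $k=l$. Theorem. The icosahedral graph, i.e. the graph formed by the 12 vertices and 30 edges of the regular icosahedron, is diagonal.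 -/

import Mathlib

open CategoryTheory

/-- The length `ℓ(x₀, …, x_k) = ∑ d(x_i, x_{i+1})` of a sequence of vertices, for the shortest-path
distance of the graph (infinite between different components). -/
noncomputable def magLength {V : Type*} (G : SimpleGraph V) : List V → ℕ∞
  | [] => 0
  | [_] => 0
  | x :: y :: t => G.edist x y + magLength G (y :: t)

/-- The sequences `(x₀, …, x_k)` with `x_i ≠ x_{i+1}` for all `i` and `ℓ(x₀, …, x_k) = l`. -/
def IsMagGenerator {V : Type*} (G : SimpleGraph V) (k l : ℕ) (xs : List V) : Prop :=
  xs.length = k + 1 ∧ xs.IsChain (· ≠ ·) ∧ magLength G xs = (l : ℕ∞)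

/-- The magnitude chain group `MC_{k,l}(G)`: the free abelian group on the generators. -/
abbrev MagChain {V : Type*} (G : SimpleGraph V) (k l : ℕ) : Type _ :=
  {xs : List V // IsMagGenerator G k l xs} →₀ ℤ

open Classical in
/-- A sequence seen as a basis element of `MC_{k,l}(G)` if it is a generator, and `0` otherwise. -/
noncomputable def magBasis {V : Type*} (G : SimpleGraph V) (k l : ℕ) (xs : List V) :
    MagChain G k l :=
  if h : IsMagGenerator G k l xs then Finsupp.single ⟨xs, h⟩ 1 else 0

/-- The differential `∂ : MC_{k+1,l}(G) → MC_{k,l}(G)`,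
`∂ (x₀, …, x_{k+1}) = ∑_{1 ≤ i ≤ k} (-1)^i ∂_i (x₀, …, x_{k+1})`, where `∂_i` removes `x_i` if this
keeps the length equal to `l`, and is `0` otherwise. (If the length is kept then consecutive
vertices are still distinct: see `magLength_eraseIdx_isChain`.) -/
noncomputable def magDifferential {V : Type*} (G : SimpleGraph V) (k l : ℕ) :
    MagChain G (k + 1) l →ₗ[ℤ] MagChain G k l :=
  Finsupp.linearCombination ℤ fun x : {xs : List V // IsMagGenerator G (k + 1) l xs} =>
    ∑ i ∈ Finset.Icc 1 k, (-1 : ℤ) ^ i • magBasis G k l (x.1.eraseIdx i)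

theorem magLength_le_cons {V : Type*} (G : SimpleGraph V) (a : V) (xs : List V) :
    magLength G xs ≤ magLength G (a :: xs) := by
  cases xs with
  | nil => simp [magLength]
  | cons b t => simp [magLength]

/-- Removing a vertex does not increase the length. -/
theorem magLength_eraseIdx_le {V : Type*} (G : SimpleGraph V) (xs : List V) (i : ℕ) :
    magLength G (xs.eraseIdx i) ≤ magLength G xs := by
  induction xs generalizing i with
  | nil => simp
  | cons a t ih =>
    cases i with
    | zero => simpa using magLength_le_cons G a t
    | succ i =>
      cases t with
      | nil => simp
      | cons b t =>
        cases i with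
        | zero =>
          cases t with
          | nil => simp [magLength]
          | cons c t =>
            simp only [List.eraseIdx_cons_succ, List.eraseIdx_cons_zero, magLength]
            rw [← add_assoc]
            gcongr
            exact G.edist_triangle
        | succ i =>
          have := ih (i + 1)
          simp only [List.eraseIdx_cons_succ, magLength] at this ⊢
          gcongr

/-- If removing a vertex keeps the (finite) length, then consecutive vertices stay distinct. -/
theorem magLength_eraseIdx_isChain {V : Type*} (G : SimpleGraph V) (xs : List V) (i : ℕ)
    (hx : xs.IsChain (· ≠ ·)) (hfin : magLength G xs ≠ ⊤)
    (h : magLength G (xs.eraseIdx i) = magLength G xs) :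
    (xs.eraseIdx i).IsChain (· ≠ ·) := by
  induction xs generalizing i with
  | nil => simp
  | cons a t ih =>
    cases i with
    | zero => simpa using hx.tail
    | succ i =>
      cases t with
      | nil => simp
      | cons b t =>
        cases i with
        | zero =>
          cases t with
          | nil => simp
          | cons c t =>
            simp only [List.eraseIdx_cons_succ, List.eraseIdx_cons_zero, magLength] at h hfin ⊢
            simp only [List.isChain_cons_cons] at hx ⊢
            refine ⟨?_, hx.2.2⟩
            rintro rfl
            have h1 : magLength G (a :: t) ≠ ⊤ := by
              intro h2
              simp [h2] at hfin
            rw [SimpleGraph.edist_self, ← add_assoc] at h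
            have h3 := ENat.add_left_injective_of_ne_top h1 h
            have h4 : G.edist a b = 0 := by
              have := h3.symm
              simp only [add_eq_zero] at this
              exact this.1
            exact hx.1 (SimpleGraph.edist_eq_zero_iff.1 h4)
        | succ i =>
          simp only [List.eraseIdx_cons_succ, magLength] at h hfin ih ⊢
          simp only [List.isChain_cons_cons] at hx ⊢
          have h1 : G.edist a b ≠ ⊤ := by
            intro h2
            simp [h2] at hfin
          have h2 : magLength G (b :: t) ≠ ⊤ := by
            intro h2
            simp [h2] at hfin
          refine ⟨hx.1, ?_⟩
          have := ih (i + 1) hx.2 h2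
          simp only [List.eraseIdx_cons_succ] at this
          exact this (ENat.add_right_injective_of_ne_top h1 h)

theorem magDifferential_magBasis {V : Type*} (G : SimpleGraph V) (k l : ℕ) (xs : List V) (i : ℕ)
    (hx : IsMagGenerator G (k + 2) l xs) (hi : i < k + 3) :
    magDifferential G k l (magBasis G (k + 1) l (xs.eraseIdx i)) =
      ∑ j ∈ Finset.Icc 1 k, (-1 : ℤ) ^ j • magBasis G k l ((xs.eraseIdx i).eraseIdx j) := by
  by_cases h : IsMagGenerator G (k + 1) l (xs.eraseIdx i)
  · simp [magBasis, magDifferential, h]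
  · obtain ⟨h1, h2, h3⟩ := hx
    have hne : magLength G (xs.eraseIdx i) ≠ (l : ℕ∞) := by
      intro h4
      refine h ⟨?_, ?_, h4⟩
      · rw [List.length_eraseIdx]
        split_ifs <;> omega
      · exact magLength_eraseIdx_isChain G xs i h2 (by simp [h3]) (by rw [h4, h3])
    have hlt : magLength G (xs.eraseIdx i) < (l : ℕ∞) :=
      lt_of_le_of_ne (h3 ▸ magLength_eraseIdx_le G xs i) hne
    have hz : ∀ j, magBasis G k l ((xs.eraseIdx i).eraseIdx j) = 0 := by
      intro j
      rw [magBasis, dif_neg]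
      rintro ⟨-, -, h5⟩
      exact ((magLength_eraseIdx_le G (xs.eraseIdx i) j).trans_lt hlt).ne h5
    have hz' : magBasis G (k + 1) l (xs.eraseIdx i) = 0 := by
      rw [magBasis, dif_neg h]
    simp only [hz, hz', map_zero, smul_zero, Finset.sum_const_zero]

theorem eraseIdx_eraseIdx_swap {V : Type*} (xs : List V) (i j : ℕ) (h : j ≤ i) :
    (xs.eraseIdx (i + 1)).eraseIdx j = (xs.eraseIdx j).eraseIdx i := by
  induction xs generalizing i j with
  | nil => simp
  | cons a t ih =>
    cases j with
    | zero => simp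
    | succ j =>
      cases i with
      | zero => omega
      | succ i => simpa using ih i j (by omega)

theorem magDifferential_comp {V : Type*} (G : SimpleGraph V) (k l : ℕ) :
    (magDifferential G k l).comp (magDifferential G (k + 1) l) = 0 := by
  refine Finsupp.lhom_ext' fun x => LinearMap.ext_ring ?_
  have h0 : magDifferential G (k + 1) l (Finsupp.single x 1) =
      ∑ i ∈ Finset.Icc 1 (k + 1), (-1 : ℤ) ^ i • magBasis G (k + 1) l (x.1.eraseIdx i) := by
    simp [magDifferential]
  simp only [LinearMap.comp_apply, Finsupp.lsingle_apply, LinearMap.zero_apply]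
  rw [h0, map_sum]
  have h1 : ∀ i ∈ Finset.Icc 1 (k + 1),
      magDifferential G k l ((-1 : ℤ) ^ i • magBasis G (k + 1) l (x.1.eraseIdx i)) =
      ∑ j ∈ Finset.Icc 1 k,
        (-1 : ℤ) ^ (i + j) • magBasis G k l ((x.1.eraseIdx i).eraseIdx j) := by
    intro i hi
    rw [Finset.mem_Icc] at hi
    rw [map_smul, magDifferential_magBasis G k l x.1 i x.2 (by omega), Finset.smul_sum]
    simp only [smul_smul, pow_add]
  rw [Finset.sum_congr rfl h1, ← Finset.sum_product']
  refine Finset.sum_involution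
    (fun p _ => if p.2 < p.1 then (p.2, p.1 - 1) else (p.2 + 1, p.1)) ?_ ?_ ?_ ?_
  · rintro ⟨i, j⟩ hp
    by_cases hji : j < i
    · obtain ⟨i, rfl⟩ : ∃ m, i = m + 1 := ⟨i - 1, by omega⟩
      simp only [hji, if_true, Nat.add_sub_cancel]
      rw [eraseIdx_eraseIdx_swap _ _ _ (by omega), ← add_smul,
        show i + 1 + j = (j + i) + 1 by omega, pow_succ]
      simp
    · simp only [hji, if_false]
      rw [eraseIdx_eraseIdx_swap _ _ _ (by omega), ← add_smul,
        show j + 1 + i = (i + j) + 1 by omega, pow_succ]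
      simp
  · rintro ⟨i, j⟩ hp _ h
    dsimp only at h
    split_ifs at h with h2 <;> simp only [Prod.mk.injEq] at h <;> omega
  · rintro ⟨i, j⟩ hp
    simp only [Finset.mem_product, Finset.mem_Icc] at hp
    dsimp only
    split_ifs with h2 <;> simp only [Finset.mem_product, Finset.mem_Icc] <;> omega
  · rintro ⟨i, j⟩ hp
    simp only [Finset.mem_product, Finset.mem_Icc] at hp
    dsimp only
    by_cases h2 : j < i
    · have h3 : ¬ (i - 1 < j) := by omega
      simp only [h2, h3, if_true, if_false, Prod.mk.injEq, and_true]
      omega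
    · have h3 : i < j + 1 := by omega
      simp [h2, h3]

/-- The magnitude chain complex `MC_{*,l}(G)`. -/
noncomputable def magnitudeComplex {V : Type*} (G : SimpleGraph V) (l : ℕ) :
    ChainComplex (ModuleCat ℤ) ℕ :=
  ChainComplex.of (fun k => ModuleCat.of ℤ (MagChain G k l))
    (fun k => ModuleCat.ofHom (magDifferential G k l))
    (fun k => by
      rw [← ModuleCat.ofHom_comp, magDifferential_comp]
      rfl)

/-- The magnitude homology `MH_{k,l}(G) = H_k(MC_{*,l}(G))`. -/
noncomputable def magnitudeHomology {V : Type*} (G : SimpleGraph V) (k l : ℕ) : ModuleCat ℤ :=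
  (magnitudeComplex G l).homology k

/-- A graph is diagonal if `MH_{k,l}(G) ≠ 0` only if `k = l`. -/
def IsDiagonalGraph {V : Type*} (G : SimpleGraph V) : Prop :=
  ∀ k l : ℕ, ¬ Limits.IsZero (magnitudeHomology G k l) → k = l

/-- The icosahedral graph (the vertices and edges of the icosahedron), with the icosahedron seen as
a pentagonal antiprism capped by two apexes: `(s, none)` is the apex on the side `s`, and
`(s, some i)`, for `i` modulo `5`, are the vertices of the pentagon on the side `s`. Each apex is
joined to its pentagon, each pentagon is a 5-cycle, and the vertex `i` of the upper pentagon is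
joined to the vertices `i` and `i + 1` of the lower one. -/
def icosahedralGraph : SimpleGraph (Bool × Option (ZMod 5)) :=
  SimpleGraph.fromRel fun x y =>
    match x, y with
    | (s, none), (t, some _) => s = t
    | (s, some i), (t, some j) =>
        (s = t ∧ j = i + 1) ∨ (s = true ∧ t = false ∧ (j = i ∨ j = i + 1))
    | _, _ => False

/-! The differential fixes the first vertex `x`, so the magnitude complex splits into complexes of
paths from `x`, and restricting the second vertex to a geodesically closed set `P` gives a
subcomplex. The proof builds `P` up one neighbour at a time, as with Koszul filtrations of algebras.
Suppose `P` is `P'` together with the vertices beyond a neighbour `u` of `x`. Modulo `P'` and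
boundaries, every chain on `P` has the form `u·c₁` (`tailChains_le`). If it is a cycle, then `c₁` is
a cycle of length one less at `u`, with second vertices in the set `J` of those `z` for which `x, u,
z` is not geodesic or `z ∈ P'` (`tailBoundary_eq_zero_of_add`). If `(u, J)` is again in the family,
induction on the length writes `c₁` as a boundary, and induction on `P` disposes of the remainder in
`P'`. This gives exactness in degrees `0 < k < l` (`exists_tailBoundary_eq`); the other off-diagonal
chain groups are zero.

For the icosahedron the family consists of the sectors: the vertices beyond `n` consecutive
neighbours of `x`. Five neighbours give all vertices except `x`, and each `J` is, away from `u`, a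
sector at `u` (`exists_icosahedralSector_eq`, a finite check). -/

variable {V : Type*}

/-! ### Complexes of paths from a fixed vertex -/

/-- Length of the path `x :: t`, for the natural-valued distance. -/
noncomputable def pathLength (G : SimpleGraph V) : V → List V → ℕ
  | _, [] => 0
  | x, y :: t => G.dist x y + pathLength G y t

/-- The vertex `y` lies on a geodesic from `x` to the head of `t`. -/
def IsBetweenHead (G : SimpleGraph V) (x y : V) (t : List V) : Prop :=
  ∃ z ∈ t.head?, G.dist x z = G.dist x y + G.dist y z

open Classical in
/-- The magnitude differential of the path `x :: t`, with paths starting at `x` represented by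
their tails. -/
noncomputable def tailBoundaryBasis (G : SimpleGraph V) : V → List V → (List V →₀ ℤ)
  | _, [] => 0
  | x, y :: t => -(if IsBetweenHead G x y t then Finsupp.single t 1 else 0) -
      Finsupp.lmapDomain ℤ ℤ (List.cons y) (tailBoundaryBasis G y t)

/-- The linear extension of `tailBoundaryBasis`. -/
noncomputable def tailBoundary (G : SimpleGraph V) (x : V) :
    (List V →₀ ℤ) →ₗ[ℤ] (List V →₀ ℤ) :=
  Finsupp.linearCombination ℤ (tailBoundaryBasis G x)

/-- The tails `t` such that `x :: t` generates `MC_{k,l}(G)` and has its second vertex in `P`. -/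
def tailGenerators (G : SimpleGraph V) (x : V) (P : Set V) (k l : ℕ) : Set (List V) :=
  {t | t.length = k ∧ (x :: t).IsChain (· ≠ ·) ∧ pathLength G x t = l ∧ ∀ z ∈ t.head?, z ∈ P}

/-- The chains on `tailGenerators`. -/
noncomputable abbrev tailChains (G : SimpleGraph V) (x : V) (P : Set V) (k l : ℕ) :
    Submodule ℤ (List V →₀ ℤ) :=
  Finsupp.supported ℤ ℤ (tailGenerators G x P k l)

/-- `P` is closed under prolonging geodesics from `x`. -/
def IsGeodesicallyClosed (G : SimpleGraph V) (x : V) (P : Set V) : Prop :=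
  ∀ z ∈ P, ∀ w, G.dist x w = G.dist x z + G.dist z w → w ∈ P

theorem tailBoundary_single (G : SimpleGraph V) (x : V) (t : List V) :
    tailBoundary G x (Finsupp.single t 1) = tailBoundaryBasis G x t := by
  simp [tailBoundary]

theorem mem_tailGenerators_cons {G : SimpleGraph V} {x y : V} {P : Set V} {k l : ℕ}
    {t : List V} :
    y :: t ∈ tailGenerators G x P (k + 1) l ↔
      x ≠ y ∧ y ∈ P ∧ ∃ m, G.dist x y + m = l ∧ t ∈ tailGenerators G y Set.univ k m := by
  simp only [tailGenerators, Set.mem_ofPred_eq, List.length_cons, List.isChain_cons_cons,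
    pathLength, List.head?_cons, Option.mem_some_iff, forall_eq', Set.mem_univ, implies_true,
    and_true, Nat.add_right_cancel_iff]
  constructor
  · rintro ⟨h1, ⟨h2, h3⟩, h4, h5⟩
    exact ⟨h2, h5, _, h4, h1, h3, rfl⟩
  · rintro ⟨h1, h2, m, h3, h4, h5, rfl⟩
    exact ⟨h4, ⟨h1, h5⟩, h3, h2⟩

theorem tailChains_mono {G : SimpleGraph V} {x : V} {P Q : Set V} {k l : ℕ}
    (h : ∀ z ∈ P, z ≠ x → z ∈ Q) : tailChains G x P k l ≤ tailChains G x Q k l := by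
  refine Finsupp.supported_mono fun t ht => ⟨ht.1, ht.2.1, ht.2.2.1, fun z hz => ?_⟩
  obtain ⟨s, rfl⟩ : ∃ s, t = z :: s := by
    cases t with
    | nil => simp at hz
    | cons y s => exact ⟨s, by simpa using hz⟩
  exact h z (ht.2.2.2 z hz) (List.isChain_cons_cons.1 ht.2.1).1.symm

theorem map_cons_tailChains_le {G : SimpleGraph V} {x y : V} {P Q : Set V} {k l m : ℕ}
    (hxy : x ≠ y) (hy : y ∈ P) (hm : G.dist x y + m = l) :
    (tailChains G y Q k m).map (Finsupp.lmapDomain ℤ ℤ (List.cons y)) ≤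
      tailChains G x P (k + 1) l := by
  rw [tailChains, Finsupp.lmapDomain_supported]
  refine Finsupp.supported_mono ?_
  rintro _ ⟨t, ht, rfl⟩
  exact mem_tailGenerators_cons.2 ⟨hxy, hy, m, hm, ht.1, ht.2.1, ht.2.2.1, by simp⟩

/-- The differential respects the grading and geodesically closed sets of second vertices. -/
theorem tailBoundaryBasis_mem (G : SimpleGraph V) (hG : G.Connected) (t : List V) :
    ∀ (x : V) (P : Set V) (k l : ℕ), IsGeodesicallyClosed G x P →
      t ∈ tailGenerators G x P (k + 1) l →
      tailBoundaryBasis G x t ∈ tailChains G x P k l := by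
  induction t with
  | nil => intro x P k l _ ht; simp [tailGenerators] at ht
  | cons y t ih =>
    intro x P k l hP ht
    obtain ⟨hxy, hy, m, hm, ht'⟩ := mem_tailGenerators_cons.1 ht
    cases t with
    -- The last vertex of a path is never removed: nothing follows it, so `IsBetweenHead` fails.
    | nil => simp [tailBoundaryBasis, IsBetweenHead]
    | cons z s =>
      obtain ⟨k, rfl⟩ : ∃ j, k = j + 1 := by
        have := ht'.1
        exact ⟨s.length, by simpa using this.symm⟩
      rw [tailBoundaryBasis]
      refine Submodule.sub_mem _ (Submodule.neg_mem _ ?_) ?_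
      · split_ifs with hb
        · refine Finsupp.single_mem_supported ℤ 1 ?_
          obtain ⟨_, hz, hd⟩ := hb
          obtain rfl : z = _ := by simpa using hz
          obtain ⟨hyz, -, m', hm', hs⟩ := mem_tailGenerators_cons.1 ht'
          -- Closedness of `P` is what keeps the new second vertex `z` in `P`; `z = x` would force
          -- `d(x, y) = 0`.
          refine mem_tailGenerators_cons.2 ⟨?_, hP y hy _ hd, m', by omega, hs⟩
          rintro rfl
          have := hG.pos_dist_of_ne hxy
          simp at hd
          omega
        · exact Submodule.zero_mem _
      · exact map_cons_tailChains_le hxy hy hm (Submodule.mem_map_of_mem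
          (ih y Set.univ k m (fun _ _ _ _ => trivial) ht'))

theorem tailBoundary_mem {G : SimpleGraph V} (hG : G.Connected) {x : V} {P : Set V} {k l : ℕ}
    (hP : IsGeodesicallyClosed G x P) {c : List V →₀ ℤ} (hc : c ∈ tailChains G x P (k + 1) l) :
    tailBoundary G x c ∈ tailChains G x P k l := by
  rw [tailChains, Finsupp.supported_eq_span_single] at hc
  have : Submodule.span ℤ ((fun i => Finsupp.single i (1 : ℤ)) ''
      tailGenerators G x P (k + 1) l) ≤ (tailChains G x P k l).comap (tailBoundary G x) := by
    rw [Submodule.span_le]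
    rintro _ ⟨t, ht, rfl⟩
    simpa [tailBoundary_single] using tailBoundaryBasis_mem G hG t x P k l hP ht
  exact this hc

-- The filtered term collects the faces that remove `y`; all later faces keep `y` and shift by one
-- position, whence the sign. Read as a homotopy formula, it makes prefixing by `y` cancel the paths
-- beyond `y`.
open Classical in
theorem tailBoundary_cons (G : SimpleGraph V) (x y : V) (c : List V →₀ ℤ) :
    tailBoundary G x (Finsupp.lmapDomain ℤ ℤ (List.cons y) c) =
      -c.filter (IsBetweenHead G x y) -
        Finsupp.lmapDomain ℤ ℤ (List.cons y) (tailBoundary G y c) := by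
  induction c using Finsupp.induction_linear with
  | zero => simp [Finsupp.filter_zero]
  | add f g hf hg =>
    simp only [map_add, hf, hg, Finsupp.filter_add]
    abel
  | single t a =>
    have h : Finsupp.single t a = a • Finsupp.single t (1 : ℤ) := by simp
    rw [h]
    simp only [map_smul, Finsupp.filter_smul, tailBoundary_single]
    rw [← smul_neg, ← smul_sub]
    congr 1
    rw [Finsupp.lmapDomain_apply, Finsupp.mapDomain_single, tailBoundary_single,
      tailBoundaryBasis]
    split_ifs with hb
    · rw [Finsupp.filter_single_of_pos _ hb]
    · rw [Finsupp.filter_single_of_neg _ hb]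

/-- A path whose second vertex `z ≠ u` lies beyond `u` is, up to sign, the face of its prefixing by
`u` that removes `u`. Modulo a boundary it can therefore be traded for paths through `u`. -/
theorem tailChains_le (G : SimpleGraph V) (hG : G.Connected) {x u : V} {P P' : Set V} {k l : ℕ}
    (hxu : G.Adj x u) (hP : P = P' ∪ {z | G.dist x z = G.dist x u + G.dist u z}) :
    tailChains G x P (k + 1) (l + 1) ≤ tailChains G x P' (k + 1) (l + 1) ⊔
      (tailChains G u Set.univ k l).map (Finsupp.lmapDomain ℤ ℤ (List.cons u)) ⊔
      (tailChains G x P (k + 2) (l + 1)).map (tailBoundary G x) := by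
  classical
  have hd : G.dist x u = 1 := SimpleGraph.dist_eq_one_iff_adj.2 hxu
  have huP : u ∈ P := by rw [hP]; right; simp
  conv_lhs => rw [tailChains, Finsupp.supported_eq_span_single]
  rw [Submodule.span_le]
  rintro _ ⟨t, ht, rfl⟩
  obtain ⟨z, s, rfl⟩ := List.exists_cons_of_length_pos (l := t) (by rw [ht.1]; omega)
  obtain ⟨hxz, hz, m, hm, hs⟩ := mem_tailGenerators_cons.1 ht
  by_cases hz' : z ∈ P'
  · refine Submodule.mem_sup_left (Submodule.mem_sup_left (Finsupp.single_mem_supported ℤ 1 ?_))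
    exact mem_tailGenerators_cons.2 ⟨hxz, hz', m, hm, hs⟩
  by_cases hzu : z = u
  · subst hzu
    refine Submodule.mem_sup_left (Submodule.mem_sup_right
      ⟨Finsupp.single s 1, Finsupp.single_mem_supported ℤ 1 ?_, by simp⟩)
    obtain rfl : m = l := by omega
    exact hs
  have hb : G.dist x z = G.dist x u + G.dist u z := by
    rw [hP] at hz
    exact hz.resolve_left hz'
  have hg : z :: s ∈ tailGenerators G u Set.univ (k + 1) l :=
    mem_tailGenerators_cons.2 ⟨Ne.symm hzu, trivial, m, by omega, hs⟩
  have hb' : IsBetweenHead G x u (z :: s) := ⟨z, by simp, hb⟩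
  have key : Finsupp.single (z :: s) (1 : ℤ) =
      -Finsupp.lmapDomain ℤ ℤ (List.cons u) (tailBoundary G u (Finsupp.single (z :: s) 1)) +
      -tailBoundary G x (Finsupp.lmapDomain ℤ ℤ (List.cons u) (Finsupp.single (z :: s) 1)) := by
    rw [tailBoundary_cons, Finsupp.filter_single_of_pos _ hb']
    abel
  dsimp only
  rw [SetLike.mem_coe, key]
  refine Submodule.add_mem _ (Submodule.neg_mem _ ?_) (Submodule.neg_mem _ ?_)
  · refine Submodule.mem_sup_left (Submodule.mem_sup_right (Submodule.mem_map_of_mem ?_))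
    exact tailBoundary_mem hG (fun _ _ _ _ => trivial) (Finsupp.single_mem_supported ℤ 1 hg)
  · refine Submodule.mem_sup_right (Submodule.mem_map_of_mem ?_)
    exact map_cons_tailChains_le hxu.ne huP (by omega)
      (Submodule.mem_map_of_mem (Finsupp.single_mem_supported ℤ 1 hg))

/-! ### Geodesic filtrations and exactness off the diagonal -/

/-- A family of pairs `(x, P)` in which every nonempty `P` arises from a smaller member `P'` by
adding the vertices beyond a neighbour `u` of `x`, the remaining vertices forming a member at
`u`: a Koszul filtration of the algebra of geodesics. -/
def IsGeodesicFiltration (G : SimpleGraph V) (F : V → Set V → Prop) : Prop :=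
  ∀ x P, F x P → P = ∅ ∨ ∃ u P' J, F x P' ∧ F u J ∧ G.Adj x u ∧ u ∉ P' ∧
    IsGeodesicallyClosed G x P' ∧ P = P' ∪ {z | G.dist x z = G.dist x u + G.dist u z} ∧
    ∀ z, z ≠ u → (z ∈ J ↔ ¬ (G.dist x z = G.dist x u + G.dist u z ∧ z ∉ P'))

/-- If `c' + u·c₁` is a cycle, with `c'` having second vertices in `P'`, then `c₁` is a cycle
and its second vertices lie in `J`. -/
theorem tailBoundary_eq_zero_of_add {G : SimpleGraph V} (hG : G.Connected) {x u : V}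
    {P' J : Set V} {k l : ℕ} (hu : u ∉ P')
    (hP' : IsGeodesicallyClosed G x P')
    (hJ : ∀ z, z ≠ u → (z ∈ J ↔ ¬ (G.dist x z = G.dist x u + G.dist u z ∧ z ∉ P')))
    {c' c₁ : List V →₀ ℤ} (hc' : c' ∈ tailChains G x P' (k + 2) (l + 1))
    (hc₁ : c₁ ∈ tailChains G u Set.univ (k + 1) l)
    (h : tailBoundary G x (c' + Finsupp.lmapDomain ℤ ℤ (List.cons u) c₁) = 0) :
    tailBoundary G u c₁ = 0 ∧ c₁ ∈ tailChains G u J (k + 1) l := by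
  classical
  have hb : tailBoundary G x c' ∈ tailChains G x P' (k + 1) (l + 1) := tailBoundary_mem hG hP' hc'
  rw [Finsupp.mem_supported'] at hb
  rw [map_add, tailBoundary_cons] at h
  have h1 : tailBoundary G u c₁ = 0 := by
    ext t
    -- At a path through `u` only `u·∂c₁` contributes: `u ∉ P'` excludes the boundary of `c'`, and
    -- paths from `u` in `c₁` do not repeat `u`.
    have e := DFunLike.congr_fun h (u :: t)
    have e1 : tailBoundary G x c' (u :: t) = 0 := hb _ fun h => hu (h.2.2.2 u (by simp))
    have e2 : c₁ (u :: t) = 0 := by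
      refine (Finsupp.mem_supported' ℤ _).1 hc₁ _ fun h => ?_
      simpa using (List.isChain_cons_cons.1 h.2.1).1
    have e3 : c₁.filter (IsBetweenHead G x u) (u :: t) = 0 := by
      rw [Finsupp.filter_apply]
      split_ifs <;> simp [e2]
    have e4 : Finsupp.lmapDomain ℤ ℤ (List.cons u) (tailBoundary G u c₁) (u :: t) =
        tailBoundary G u c₁ t := by
      rw [Finsupp.lmapDomain_apply]
      exact Finsupp.mapDomain_apply List.cons_injective _ _
    simp only [Finsupp.add_apply, Finsupp.sub_apply, Finsupp.neg_apply, e1, e3, e4] at e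
    simpa using e
  refine ⟨h1, ?_⟩
  rw [h1, map_zero, sub_zero] at h
  rw [Finsupp.mem_supported']
  intro t ht
  by_cases hg : t ∈ tailGenerators G u Set.univ (k + 1) l
  · obtain ⟨z, s, rfl⟩ := List.exists_cons_of_length_pos (l := t) (by rw [hg.1]; omega)
    have hzu : z ≠ u := fun h => (List.isChain_cons_cons.1 hg.2.1).1 h.symm
    have hz : z ∉ J := by
      intro hz
      refine ht ⟨hg.1, hg.2.1, hg.2.2.1, ?_⟩
      simpa using hz
    rw [hJ z hzu, not_not] at hz
    -- Here `z` is beyond `u` and outside `P'`, so the only contribution at `z :: s` is the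
    -- coefficient of `c₁`.
    have e := DFunLike.congr_fun h (z :: s)
    have e1 : tailBoundary G x c' (z :: s) = 0 := hb _ fun h => hz.2 (h.2.2.2 z (by simp))
    have e2 : c₁.filter (IsBetweenHead G x u) (z :: s) = c₁ (z :: s) :=
      Finsupp.filter_apply_pos _ _ ⟨z, by simp, hz.1⟩
    simp only [Finsupp.add_apply, Finsupp.neg_apply, e1, e2] at e
    simpa using e
  · exact (Finsupp.mem_supported' ℤ _).1 hc₁ _ hg

/-- With `w` the head of `s`, both sides say that `d(x, w) = d(x, y) + d(y, z) + d(z, w)`. This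
associativity of geodesic concatenation is the source of `∂² = 0`. -/
theorem isBetweenHead_comm {G : SimpleGraph V} (hG : G.Connected) (x y z : V) (s : List V) :
    IsBetweenHead G x y s ∧ IsBetweenHead G y z s ↔
      G.dist x z = G.dist x y + G.dist y z ∧ IsBetweenHead G x z s := by
  cases s with
  | nil => simp [IsBetweenHead]
  | cons w r =>
    simp only [IsBetweenHead, List.head?_cons, Option.mem_some_iff, exists_eq_left']
    have h1 := hG.dist_triangle (u := x) (v := y) (w := w)
    have h2 := hG.dist_triangle (u := y) (v := z) (w := w)
    have h3 := hG.dist_triangle (u := x) (v := y) (w := z)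
    have h4 := hG.dist_triangle (u := x) (v := z) (w := w)
    omega

-- This is the commutation of removing `y` with the later faces, needed to cancel the cross terms of
-- `∂²` in `tailBoundary_tailBoundary`.
open Classical in
theorem filter_tailBoundaryBasis {G : SimpleGraph V} (hG : G.Connected) (x y : V) (t : List V) :
    (tailBoundaryBasis G y t).filter (IsBetweenHead G x y) =
      if IsBetweenHead G x y t then tailBoundaryBasis G x t else 0 := by
  cases t with
  | nil => simp [tailBoundaryBasis, Finsupp.filter_zero]
  | cons z s =>
    have h0 : IsBetweenHead G x y (z :: s) ↔ G.dist x z = G.dist x y + G.dist y z := by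
      simp [IsBetweenHead]
    have h1 : (Finsupp.lmapDomain ℤ ℤ (List.cons z) (tailBoundaryBasis G z s)).filter
        (IsBetweenHead G x y) = if IsBetweenHead G x y (z :: s) then
          Finsupp.lmapDomain ℤ ℤ (List.cons z) (tailBoundaryBasis G z s) else 0 := by
      ext r
      rw [Finsupp.filter_apply]
      by_cases hr : r ∈ Set.range (List.cons z)
      · obtain ⟨r, rfl⟩ := hr
        have h2 : IsBetweenHead G x y (z :: r) ↔ IsBetweenHead G x y (z :: s) := by
          simp [IsBetweenHead]
        split_ifs <;> tauto
      · have h2 : Finsupp.lmapDomain ℤ ℤ (List.cons z) (tailBoundaryBasis G z s) r = 0 :=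
          Finsupp.mapDomain_of_notMem_range _ _ hr
        split_ifs <;> first | rfl | exact h2 | exact h2.symm
    have h3 := isBetweenHead_comm hG x y z s
    rw [tailBoundaryBasis, tailBoundaryBasis, Finsupp.filter_sub, Finsupp.filter_neg, h1]
    by_cases ha : IsBetweenHead G y z s <;> by_cases hb : IsBetweenHead G x y (z :: s) <;>
      by_cases hc : IsBetweenHead G x z s <;> by_cases hd : IsBetweenHead G x y s <;>
      first
      | (exfalso; tauto)
      | simp [ha, hb, hc, hd, Finsupp.filter_zero]

theorem tailBoundary_tailBoundary {G : SimpleGraph V} (hG : G.Connected) (x : V)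
    (c : List V →₀ ℤ) : tailBoundary G x (tailBoundary G x c) = 0 := by
  classical
  induction c using Finsupp.induction_linear with
  | zero => simp
  | add f g hf hg => simp [hf, hg]
  | single t a =>
    rw [show Finsupp.single t a = a • Finsupp.single t (1 : ℤ) by simp, map_smul, map_smul,
      tailBoundary_single]
    suffices h : tailBoundary G x (tailBoundaryBasis G x t) = 0 by rw [h, smul_zero]
    induction t generalizing x with
    | nil => simp [tailBoundaryBasis]
    | cons y t ih =>
      rw [tailBoundaryBasis, map_sub, map_neg, tailBoundary_cons, ih,
        filter_tailBoundaryBasis hG]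
      split_ifs <;> simp [tailBoundary_single]

/-- A geodesic filtration forces exactness of the chains off the diagonal. -/
theorem exists_tailBoundary_eq [Finite V] {G : SimpleGraph V} (hG : G.Connected)
    {F : V → Set V → Prop} (hF : IsGeodesicFiltration G F) (l : ℕ) :
    ∀ k, k + 1 < l → ∀ x P, F x P → ∀ c ∈ tailChains G x P (k + 1) l, tailBoundary G x c = 0 →
      ∃ b ∈ tailChains G x P (k + 2) l, tailBoundary G x b = c := by
  induction l with
  | zero => intro k hk; omega
  | succ l ihl =>
    intro k hk x P
    induction P using WellFoundedLT.induction with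
    | ind P ihP =>
    intro hP c hc hcycle
    obtain rfl | ⟨u, P', J, hFP', hFJ, hxu, hu, hP', rfl, hJ⟩ := hF x P hP
    · refine ⟨0, Submodule.zero_mem _, ?_⟩
      rw [map_zero, eq_comm]
      ext t
      refine (Finsupp.mem_supported' ℤ _).1 hc t fun ht => ?_
      obtain ⟨z, s, rfl⟩ := List.exists_cons_of_length_pos (l := t) (by rw [ht.1]; omega)
      exact ht.2.2.2 z (by simp)
    set P := P' ∪ {z | G.dist x z = G.dist x u + G.dist u z} with hPdef
    have hd : G.dist x u = 1 := SimpleGraph.dist_eq_one_iff_adj.2 hxu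
    have huP : u ∈ P := by right; simp
    have hsub : P' ⊆ P := Set.subset_union_left
    have hmono : tailChains G x P' (k + 2) (l + 1) ≤ tailChains G x P (k + 2) (l + 1) :=
      tailChains_mono fun z hz _ => hsub hz
    obtain ⟨d, hd', e, ⟨b₀, hb₀, rfl⟩, hde⟩ := Submodule.mem_sup.1 (tailChains_le G hG hxu hPdef hc)
    obtain ⟨c', hc', f, ⟨c₁, hc₁, rfl⟩, rfl⟩ := Submodule.mem_sup.1 hd'
    have hcyc : tailBoundary G x (c' + Finsupp.lmapDomain ℤ ℤ (List.cons u) c₁) = 0 := by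
      rw [← hde, map_add, tailBoundary_tailBoundary hG, add_zero] at hcycle
      exact hcycle
    have hlt : P' < P := (Set.ssubset_iff_of_subset hsub).2 ⟨u, huP, hu⟩
    -- it suffices to make the part at `u` homologous to a chain in `P'`
    suffices H : ∃ b₁ ∈ tailChains G x P (k + 2) (l + 1), c' +
        Finsupp.lmapDomain ℤ ℤ (List.cons u) c₁ + tailBoundary G x b₁ ∈
          tailChains G x P' (k + 1) (l + 1) by
      obtain ⟨b₁, hb₁, hmem⟩ := H
      obtain ⟨b₂, hb₂, hb₂'⟩ := ihP P' hlt hFP' _ hmem (by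
        rw [map_add, hcyc, tailBoundary_tailBoundary hG, add_zero])
      refine ⟨b₀ + b₂ - b₁, Submodule.sub_mem _ (Submodule.add_mem _ hb₀ (hmono hb₂)) hb₁, ?_⟩
      rw [map_sub, map_add, hb₂', ← hde]
      abel
    cases k with
    | zero =>
      -- Here `c₁` consists of one-vertex paths, of length `0`, while the grading requires the
      -- positive length `l`.
      have h0 : c₁ = 0 := by
        ext t
        refine (Finsupp.mem_supported' ℤ _).1 hc₁ t fun ht => ?_
        obtain rfl : t = [] := List.eq_nil_of_length_eq_zero ht.1
        have := ht.2.2.1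
        simp [pathLength] at this
        omega
      exact ⟨0, Submodule.zero_mem _, by simpa [h0] using hc'⟩
    | succ k =>
      classical
      obtain ⟨h1, h2⟩ := tailBoundary_eq_zero_of_add hG hu hP' hJ hc' hc₁ hcyc
      obtain ⟨b, hb, hb'⟩ := ihl k (by omega) u J hFJ c₁ h2 h1
      -- Since `∂b = c₁`, the boundary of `u·b` is `-u·c₁` minus the part of `b` beyond `u`. That
      -- part has second vertices in `J` and beyond `u`, hence in `P'`.
      refine ⟨Finsupp.lmapDomain ℤ ℤ (List.cons u) b, map_cons_tailChains_le hxu.ne huP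
        (by omega) (Submodule.mem_map_of_mem hb), ?_⟩
      rw [tailBoundary_cons, hb', add_assoc, sub_eq_add_neg, add_comm (-_) (-_), ← add_assoc,
        ← add_assoc, add_neg_cancel_right]
      refine Submodule.add_mem _ hc' (Submodule.neg_mem _ ?_)
      rw [Finsupp.mem_supported']
      intro t ht
      rw [Finsupp.filter_apply]
      split_ifs with hbt
      · refine (Finsupp.mem_supported' ℤ _).1 hb t fun hg => ht ?_
        obtain ⟨z, s, rfl⟩ := List.exists_cons_of_length_pos (l := t) (by rw [hg.1]; omega)
        obtain ⟨huz, hzJ, m, hm, hs⟩ := mem_tailGenerators_cons.1 hg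
        obtain ⟨_, hz, hxz⟩ := hbt
        obtain rfl : z = _ := by simpa using hz
        have hzP : z ∈ P' := by
          have := (hJ z huz.symm).1 hzJ
          tauto
        refine mem_tailGenerators_cons.2 ⟨?_, hzP, m, by omega, hs⟩
        rintro rfl
        simp at hxz
        omega
      · rfl

/-! ### Splitting the magnitude complex by first vertex -/

/-- Paths from `x`, represented by their tails, as magnitude chains. -/
noncomputable def tailToMagChain (G : SimpleGraph V) (k l : ℕ) (x : V) :
    (List V →₀ ℤ) →ₗ[ℤ] MagChain G k l :=
  Finsupp.linearCombination ℤ fun t => magBasis G k l (x :: t)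

open Classical in
/-- The part of a magnitude chain supported on the paths from `x`. -/
noncomputable def magChainToTail (G : SimpleGraph V) (k l : ℕ) (x : V) :
    MagChain G k l →ₗ[ℤ] (List V →₀ ℤ) :=
  Finsupp.linearCombination ℤ fun xs =>
    if xs.1.head? = some x then Finsupp.single xs.1.tail 1 else 0

theorem magLength_cons {G : SimpleGraph V} (hG : G.Connected) (x : V) (t : List V) :
    magLength G (x :: t) = (pathLength G x t : ℕ∞) := by
  induction t generalizing x with
  | nil => simp [magLength, pathLength]
  | cons y t ih =>
    rw [magLength, pathLength, ih, Nat.cast_add, (hG x y).coe_dist_eq_edist]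

theorem isMagGenerator_cons_iff {G : SimpleGraph V} (hG : G.Connected) {x : V} {t : List V}
    {k l : ℕ} : IsMagGenerator G k l (x :: t) ↔ t ∈ tailGenerators G x Set.univ k l := by
  simp [IsMagGenerator, tailGenerators, magLength_cons hG]

-- This identifies the recursive boundary with the alternating sum of faces. Position `i` in the
-- tail is position `i + 1` in the path, and the last position is omitted.
open Classical in
theorem tailBoundaryBasis_eq_sum (G : SimpleGraph V) (x : V) (t : List V) :
    tailBoundaryBasis G x t = ∑ i ∈ Finset.range (t.length - 1), (-1 : ℤ) ^ (i + 1) •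
      if pathLength G x (t.eraseIdx i) = pathLength G x t then
        Finsupp.single (t.eraseIdx i) (1 : ℤ) else 0 := by
  induction t generalizing x with
  | nil => simp [tailBoundaryBasis]
  | cons y t ih =>
    cases t with
    | nil => simp [tailBoundaryBasis, IsBetweenHead]
    | cons z s =>
      have h0 : IsBetweenHead G x y (z :: s) ↔
          pathLength G x (z :: s) = pathLength G x (y :: z :: s) := by
        simp only [IsBetweenHead, pathLength, List.head?_cons, Option.mem_some_iff,
          exists_eq_left']
        omega
      rw [tailBoundaryBasis, ih]
      simp only [List.length_cons, Nat.add_sub_cancel]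
      rw [Finset.sum_range_succ', sub_eq_add_neg, add_comm]
      congr 1
      · rw [map_sum, ← Finset.sum_neg_distrib]
        refine Finset.sum_congr rfl fun i _ => ?_
        rw [map_smul, pow_succ _ (i + 1), mul_neg_one, neg_smul]
        congr 2
        simp only [List.eraseIdx_cons_succ, pathLength.eq_2 G x y, Nat.add_left_cancel_iff]
        split_ifs <;> simp
      · rw [List.eraseIdx_cons_zero]
        simp only [h0]
        split_ifs <;> simp

theorem magDifferential_single {G : SimpleGraph V} (hG : G.Connected) {x : V} {t : List V}
    {k l : ℕ} (h : IsMagGenerator G (k + 1) l (x :: t)) :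
    magDifferential G k l (Finsupp.single ⟨x :: t, h⟩ 1) =
      tailToMagChain G k l x (tailBoundaryBasis G x t) := by
  classical
  have hl : t.length = k + 1 := by simpa using h.1
  have hlen := ((isMagGenerator_cons_iff hG).1 h).2.2.1
  rw [tailBoundaryBasis_eq_sum, map_sum, hl, Nat.add_sub_cancel]
  simp only [magDifferential, Finsupp.linearCombination_single, one_smul]
  rw [show Finset.Icc 1 k = Finset.Ico (0 + 1) (k + 1) by ext; simp,
    ← Finset.sum_Ico_add', Finset.range_eq_Ico]
  refine Finset.sum_congr rfl fun i _ => ?_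
  rw [map_smul, List.eraseIdx_cons_succ]
  congr 1
  split_ifs with hi
  · simp [tailToMagChain]
  -- A face that changes the length is not a generator, so `magBasis` takes its default value `0`.
  · rw [map_zero, magBasis, dif_neg]
    rw [isMagGenerator_cons_iff hG]
    exact fun hg => hi (hg.2.2.1.trans hlen.symm)

theorem tailToMagChain_magChainToTail [Fintype V] (G : SimpleGraph V) (k l : ℕ)
    (c : MagChain G k l) :
    ∑ x, tailToMagChain G k l x (magChainToTail G k l x c) = c := by
  classical
  induction c using Finsupp.induction_linear with
  | zero => simp
  | add f g hf hg => simp [Finset.sum_add_distrib, hf, hg]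
  | single xs a =>
    obtain ⟨xs, h⟩ := xs
    cases xs with
    | nil => exact absurd h.1 (by simp)
    | cons y t =>
      rw [Finset.sum_eq_single y]
      · simp [magChainToTail, tailToMagChain, magBasis, h]
      · intro x _ hx
        simp [magChainToTail, hx.symm]
      · simp

theorem magChainToTail_mem {G : SimpleGraph V} (hG : G.Connected) (k l : ℕ) (x : V)
    (c : MagChain G k l) : magChainToTail G k l x c ∈ tailChains G x Set.univ k l := by
  classical
  induction c using Finsupp.induction_linear with
  | zero => simp
  | add f g hf hg => rw [map_add]; exact Submodule.add_mem _ hf hg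
  | single xs a =>
    obtain ⟨xs, h⟩ := xs
    rw [magChainToTail, Finsupp.linearCombination_single]
    refine Submodule.smul_mem _ _ ?_
    split_ifs with hx
    · cases xs with
      | nil => simp at hx
      | cons y t =>
        obtain rfl : y = x := by simpa using hx
        exact Finsupp.single_mem_supported ℤ 1 ((isMagGenerator_cons_iff hG).1 h)
    · exact Submodule.zero_mem _

theorem magDifferential_tailToMagChain {G : SimpleGraph V} (hG : G.Connected) {k l : ℕ} {x : V}
    {c : List V →₀ ℤ} (hc : c ∈ tailChains G x Set.univ (k + 1) l) :
    magDifferential G k l (tailToMagChain G (k + 1) l x c) =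
      tailToMagChain G k l x (tailBoundary G x c) := by
  rw [tailChains, Finsupp.supported_eq_span_single] at hc
  refine LinearMap.eqOn_span (f := (magDifferential G k l).comp (tailToMagChain G (k + 1) l x))
    (g := (tailToMagChain G k l x).comp (tailBoundary G x)) ?_ hc
  rintro _ ⟨t, ht, rfl⟩
  have h := (isMagGenerator_cons_iff hG).2 ht
  simp only [LinearMap.comp_apply, tailBoundary_single]
  rw [← magDifferential_single hG h]
  simp [tailToMagChain, magBasis, h]

theorem magChainToTail_tailToMagChain {G : SimpleGraph V} (hG : G.Connected) {k l : ℕ} {x : V}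
    {c : List V →₀ ℤ} (hc : c ∈ tailChains G x Set.univ k l) :
    magChainToTail G k l x (tailToMagChain G k l x c) = c := by
  rw [tailChains, Finsupp.supported_eq_span_single] at hc
  refine LinearMap.eqOn_span (f := (magChainToTail G k l x).comp (tailToMagChain G k l x))
    (g := LinearMap.id) ?_ hc
  rintro _ ⟨t, ht, rfl⟩
  have h := (isMagGenerator_cons_iff hG).2 ht
  simp [tailToMagChain, magChainToTail, magBasis, h]

theorem magChainToTail_tailToMagChain_of_ne (G : SimpleGraph V) {k l : ℕ} {x y : V} (hxy : x ≠ y)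
    (c : List V →₀ ℤ) : magChainToTail G k l x (tailToMagChain G k l y c) = 0 := by
  classical
  induction c using Finsupp.induction_linear with
  | zero => simp
  | add f g hf hg => simp [hf, hg]
  | single t a =>
    by_cases h : IsMagGenerator G k l (y :: t) <;>
      simp [tailToMagChain, magChainToTail, magBasis, h, hxy.symm]

theorem exists_magDifferential_eq [Finite V] {G : SimpleGraph V} (hG : G.Connected)
    {F : V → Set V → Prop} (hF : IsGeodesicFiltration G F) (hF' : ∀ x, F x {x}ᶜ) {k l : ℕ}
    (hk : k + 1 < l) (c : MagChain G (k + 1) l) (hc : magDifferential G k l c = 0) :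
    ∃ b, magDifferential G (k + 1) l b = c := by
  classical
  have := Fintype.ofFinite V
  have key : ∀ x, ∃ b ∈ tailChains G x Set.univ (k + 2) l,
      tailBoundary G x b = magChainToTail G (k + 1) l x c := by
    intro x
    have hm := magChainToTail_mem hG (k + 1) l x c
    have hcyc : tailBoundary G x (magChainToTail G (k + 1) l x c) = 0 := by
      have hm' := fun y => magChainToTail_mem hG (k + 1) l y c
      have hb : ∀ y, tailBoundary G y (magChainToTail G (k + 1) l y c) ∈
          tailChains G y Set.univ k l := fun y => tailBoundary_mem hG (fun _ _ _ _ => trivial) (hm' y)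
      have e := congrArg (magChainToTail G k l x) hc
      rw [← tailToMagChain_magChainToTail G (k + 1) l c, map_sum, map_sum, map_zero,
        Finset.sum_eq_single x, magDifferential_tailToMagChain hG (hm' x),
        magChainToTail_tailToMagChain hG (hb x)] at e
      · exact e
      · intro y _ hy
        rw [magDifferential_tailToMagChain hG (hm' y),
          magChainToTail_tailToMagChain_of_ne G hy.symm]
      · simp
    -- Second vertices differ from `x` anyway, so the full complex at `x` is the one attached to
    -- `{x}ᶜ`.
    have hm2 : magChainToTail G (k + 1) l x c ∈ tailChains G x {x}ᶜ (k + 1) l :=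
      tailChains_mono (fun z _ hz => hz) hm
    obtain ⟨b, hb, hb'⟩ := exists_tailBoundary_eq hG hF l k hk x _ (hF' x) _ hm2 hcyc
    exact ⟨b, tailChains_mono (fun _ _ _ => trivial) hb, hb'⟩
  choose b hb hb' using key
  refine ⟨∑ x, tailToMagChain G (k + 2) l x (b x), ?_⟩
  rw [map_sum, ← tailToMagChain_magChainToTail G (k + 1) l c]
  refine Finset.sum_congr rfl fun x _ => ?_
  rw [magDifferential_tailToMagChain hG (hb x), hb']

theorem length_le_pathLength {G : SimpleGraph V} (hG : G.Connected) (x : V) (t : List V)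
    (h : (x :: t).IsChain (· ≠ ·)) : t.length ≤ pathLength G x t := by
  induction t generalizing x with
  | nil => simp
  | cons y t ih =>
    rw [List.isChain_cons_cons] at h
    have := hG.pos_dist_of_ne h.1
    have := ih y h.2
    simp only [List.length_cons, pathLength]
    omega

/-- Each of the `k` steps has length at least `1`, and a single vertex has length `0`. This covers
every off-diagonal bidegree except `0 < k < l`. -/
theorem isEmpty_isMagGenerator {G : SimpleGraph V} (hG : G.Connected) {k l : ℕ}
    (h : l < k ∨ k = 0 ∧ l ≠ 0) : IsEmpty {xs : List V // IsMagGenerator G k l xs} := by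
  refine ⟨fun ⟨xs, hxs⟩ => ?_⟩
  cases xs with
  | nil => exact absurd hxs.1 (by simp)
  | cons x t =>
    rw [isMagGenerator_cons_iff hG] at hxs
    have h1 := length_le_pathLength hG x t hxs.2.1
    have h2 := hxs.1
    have h3 := hxs.2.2.1
    obtain h | ⟨rfl, h⟩ := h
    · omega
    · obtain rfl : t = [] := List.eq_nil_of_length_eq_zero h2
      simp [pathLength] at h3
      omega

/-- A finite connected graph with a geodesic filtration containing every `(x, V \ {x})` is
diagonal. -/
theorem IsGeodesicFiltration.isDiagonalGraph [Finite V] {G : SimpleGraph V} (hG : G.Connected)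
    {F : V → Set V → Prop} (hF : IsGeodesicFiltration G F) (hF' : ∀ x, F x {x}ᶜ) :
    IsDiagonalGraph G := by
  intro k l
  contrapose
  intro hkl
  rw [magnitudeHomology, ← HomologicalComplex.exactAt_iff_isZero_homology]
  by_cases h : l < k ∨ k = 0 ∧ l ≠ 0
  · have := isEmpty_isMagGenerator hG h
    have hz : Limits.IsZero ((magnitudeComplex G l).X k) :=
      ModuleCat.isZero_of_subsingleton (ModuleCat.of ℤ (MagChain G k l))
    exact ShortComplex.exact_of_isZero_X₂ _ hz
  · obtain ⟨k, rfl⟩ : ∃ j, k = j + 1 := ⟨k - 1, by omega⟩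
    rw [HomologicalComplex.exactAt_iff' _ (k + 2) (k + 1) k (by simp) (by simp),
      ShortComplex.moduleCat_exact_iff]
    intro c hc
    have hd : ∀ j, (magnitudeComplex G l).d (j + 1) j =
        ModuleCat.ofHom (magDifferential G j l) := fun j =>
      ChainComplex.of_d (fun j => ModuleCat.of ℤ (MagChain G j l))
        (fun j => ModuleCat.ofHom (magDifferential G j l)) j
    change ((magnitudeComplex G l).d (k + 1) k).hom c = 0 at hc
    rw [hd] at hc
    obtain ⟨b, hb⟩ := exists_magDifferential_eq hG hF hF' (l := l) (by omega) c hc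
    refine ⟨b, ?_⟩
    change ((magnitudeComplex G l).d (k + 2) (k + 1)).hom b = c
    rw [hd]
    exact hb

/-! ### The icosahedron and its sectors -/

/-- The distance of the icosahedral graph. -/
def icosahedralDist : Bool × Option (ZMod 5) → Bool × Option (ZMod 5) → ℕ
  | (s, none), (t, none) => if s = t then 0 else 3
  | (s, none), (t, some _) => if s = t then 1 else 2
  | (s, some _), (t, none) => if s = t then 1 else 2
  | (true, some i), (true, some j) | (false, some i), (false, some j) =>
      if i = j then 0 else if j = i + 1 ∨ i = j + 1 then 1 else 2
  | (true, some i), (false, some j) | (false, some j), (true, some i) =>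
      if j = i ∨ j = i + 1 then 1 else if j = i + 3 then 3 else 2

/-- The neighbours of a vertex of the icosahedron, in counterclockwise order. -/
def icosahedralNeighbor : Bool × Option (ZMod 5) → ZMod 5 → Bool × Option (ZMod 5)
  | (true, none), p => (true, some p)
  | (false, none), p => (false, some (-p))
  | (true, some i), p => if p = 0 then (true, none) else if p = 1 then (true, some (i - 1)) else
      if p = 2 then (false, some i) else if p = 3 then (false, some (i + 1)) else
        (true, some (i + 1))
  | (false, some i), p => if p = 0 then (false, none) else if p = 1 then (false, some (i + 1)) else
      if p = 2 then (true, some i) else if p = 3 then (true, some (i - 1)) else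
        (false, some (i - 1))

/-- The vertices beyond one of the `n` consecutive neighbours of `x` from position `p` on. -/
def icosahedralSector (x : Bool × Option (ZMod 5)) (p : ZMod 5) (n : ℕ) :
    Set (Bool × Option (ZMod 5)) :=
  {z | ∃ m < n, icosahedralDist x z =
    1 + icosahedralDist (icosahedralNeighbor x (p + (m : ZMod 5))) z}

instance (x : Bool × Option (ZMod 5)) (p : ZMod 5) (n : ℕ) (z : Bool × Option (ZMod 5)) :
    Decidable (z ∈ icosahedralSector x p n) :=
  inferInstanceAs (Decidable (∃ m < n, icosahedralDist x z =
    1 + icosahedralDist (icosahedralNeighbor x (p + (m : ZMod 5))) z))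

theorem icosahedralGraph_adj_iff : ∀ x y,
    icosahedralGraph.Adj x y ↔ icosahedralDist x y = 1 := by
  rintro ⟨s, i⟩ ⟨t, j⟩
  rw [icosahedralGraph, SimpleGraph.fromRel_adj]
  rcases i with _ | i <;> rcases j with _ | j
  · revert s t; decide
  · revert s t j; decide
  · revert s t i; decide
  · revert s t i j; decide +kernel

theorem icosahedralDist_self : ∀ x, icosahedralDist x x = 0 := by decide +kernel

theorem icosahedralDist_le_of_adj : ∀ x y z, icosahedralDist x y = 1 →
    icosahedralDist x z ≤ icosahedralDist y z + 1 := by decide +kernel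

/-- Greedy descent along such neighbours yields a walk of length `icosahedralDist x z`;
`icosahedralDist_le_of_adj` shows that no walk is shorter. -/
theorem exists_icosahedralDist_succ : ∀ x z, x ≠ z → ∃ p,
    icosahedralDist x (icosahedralNeighbor x p) = 1 ∧
    icosahedralDist x z = icosahedralDist (icosahedralNeighbor x p) z + 1 := by decide +kernel

theorem icosahedralDist_le_length {x y : Bool × Option (ZMod 5)} (w : icosahedralGraph.Walk x y) :
    icosahedralDist x y ≤ w.length := by
  induction w with
  | nil => simp [icosahedralDist_self]
  | cons h w ih =>
    rw [SimpleGraph.Walk.length_cons]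
    exact (icosahedralDist_le_of_adj _ _ _ ((icosahedralGraph_adj_iff _ _).1 h)).trans
      (Nat.add_le_add_right ih 1)

theorem exists_walk_length_eq (n : ℕ) (x y : Bool × Option (ZMod 5))
    (h : icosahedralDist x y = n) : ∃ w : icosahedralGraph.Walk x y, w.length = n := by
  induction n generalizing x with
  | zero =>
    by_cases hxy : x = y
    · subst hxy; exact ⟨.nil, rfl⟩
    · obtain ⟨p, -, hp⟩ := exists_icosahedralDist_succ x y hxy
      omega
  | succ n ih =>
    have hxy : x ≠ y := by
      rintro rfl
      rw [icosahedralDist_self] at h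
      omega
    obtain ⟨p, hp, hp'⟩ := exists_icosahedralDist_succ x y hxy
    obtain ⟨w, hw⟩ := ih (icosahedralNeighbor x p) (by omega)
    exact ⟨.cons ((icosahedralGraph_adj_iff _ _).2 hp) w, by simp [hw]⟩

theorem icosahedralGraph_connected : icosahedralGraph.Connected :=
  ⟨fun x y => ⟨(exists_walk_length_eq _ x y rfl).choose⟩⟩

theorem icosahedralGraph_dist (x y : Bool × Option (ZMod 5)) :
    icosahedralGraph.dist x y = icosahedralDist x y := by
  obtain ⟨w, hw⟩ := exists_walk_length_eq _ x y rfl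
  obtain ⟨w', hw'⟩ := icosahedralGraph_connected.exists_walk_length_eq_dist x y
  exact le_antisymm (hw ▸ SimpleGraph.dist_le w) (hw' ▸ icosahedralDist_le_length w')

theorem icosahedralNeighbor_dist : ∀ x p, icosahedralDist x (icosahedralNeighbor x p) = 1 := by
  decide +kernel

theorem icosahedralNeighbor_notMem_sector : ∀ x p, ∀ n : ℕ, n < 5 →
    icosahedralNeighbor x (p + (n : ZMod 5)) ∉ icosahedralSector x p n := by
  decide +kernel

-- The set to match is `J` at `u`, the neighbour of `x` at position `p + n`. Beyond `u` lie `u`, the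
-- two neighbours of `u` at distance 2 from `x`, and the antipode of `x`. For `n = 0` the set `J`
-- comes from the three consecutive neighbours of `u` centred at `x`. For `n = 1, 2, 3` one of the
-- outer neighbours of `u` is already in `P'`, and four neighbours of `u` are used; for `n = 4` both
-- are, and all five are used.
set_option synthInstance.maxHeartbeats 400000 in
set_option synthInstance.maxSize 4096 in
theorem exists_icosahedralSector_eq : ∀ x p, ∀ n : ℕ, n < 5 → ∃ q, ∃ m : Fin 6, ∀ z,
    z ≠ icosahedralNeighbor x (p + (n : ZMod 5)) →
    (z ∈ icosahedralSector (icosahedralNeighbor x (p + (n : ZMod 5))) q m ↔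
      ¬ (icosahedralDist x z = 1 + icosahedralDist (icosahedralNeighbor x (p + (n : ZMod 5))) z ∧
        z ∉ icosahedralSector x p n)) := by
  decide +kernel

theorem icosahedralSector_five : ∀ x z, z ∈ icosahedralSector x 0 5 ↔ z ≠ x := by
  decide +kernel

/-- If a geodesic from `x` to `z` can start through a neighbour `u`, then so can any prolongation of
it, by the triangle inequality. -/
theorem isGeodesicallyClosed_icosahedralSector (x : Bool × Option (ZMod 5)) (p : ZMod 5) (n : ℕ) :
    IsGeodesicallyClosed icosahedralGraph x (icosahedralSector x p n) := by
  rintro z ⟨m, hm, hz⟩ w hw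
  refine ⟨m, hm, ?_⟩
  have h := icosahedralGraph_connected.dist_triangle
    (u := icosahedralNeighbor x (p + (m : ZMod 5))) (v := z) (w := w)
  have h' := icosahedralGraph_connected.dist_triangle
    (u := x) (v := icosahedralNeighbor x (p + (m : ZMod 5))) (w := w)
  simp only [icosahedralGraph_dist, icosahedralNeighbor_dist] at h h' hw
  omega

theorem isGeodesicFiltration_icosahedralSector : IsGeodesicFiltration icosahedralGraph
    fun x P => ∃ p, ∃ n ≤ 5, P = icosahedralSector x p n := by
  rintro x _ ⟨p, n, hn, rfl⟩
  cases n with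
  | zero => left; ext; simp [icosahedralSector]
  | succ n =>
    right
    obtain ⟨q, m, h⟩ := exists_icosahedralSector_eq x p n (by omega)
    -- The last neighbour of the sector plays the role of `u`, and the sector of the first `n`
    -- neighbours that of `P'`.
    refine ⟨icosahedralNeighbor x (p + (n : ZMod 5)), icosahedralSector x p n, _,
      ⟨p, n, by omega, rfl⟩, ⟨q, m, Nat.lt_succ_iff.1 m.2, rfl⟩,
      (icosahedralGraph_adj_iff _ _).2 (icosahedralNeighbor_dist _ _),
      icosahedralNeighbor_notMem_sector x p n (by omega),
      isGeodesicallyClosed_icosahedralSector x p n, ?_, ?_⟩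
    · ext z
      simp only [icosahedralGraph_dist, icosahedralNeighbor_dist, icosahedralSector,
        Nat.lt_succ_iff_lt_or_eq, Set.mem_union, Set.mem_ofPred_eq]
      constructor
      · rintro ⟨j, hj | rfl, hz⟩
        · exact .inl ⟨j, hj, hz⟩
        · exact .inr hz
      · rintro (⟨j, hj, hz⟩ | hz)
        · exact ⟨j, .inl hj, hz⟩
        · exact ⟨n, .inr rfl, hz⟩
    · simpa only [icosahedralGraph_dist, icosahedralNeighbor_dist] using h

theorem mainTheorem2 : IsDiagonalGraph icosahedralGraph := by
  refine isGeodesicFiltration_icosahedralSector.isDiagonalGraph icosahedralGraph_connected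
    fun x => ⟨0, 5, le_rfl, ?_⟩
  ext z
  exact (icosahedralSector_five x z).symm
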